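/- Let $\mathcal{X}$ be a smooth absolutely irreducible projective curve over a finite field $\mathbb{F}$, let $P_1,\dots,P_n,Q$ be distinct rational points of $\mathcal{X}$, and let $D=P_1+\cdots+P_n$. For an integer $a$ let $L(aQ)$ be the Riemann–Roch space of the divisor $aQ$ and let $$C_L(D,aQ)=\{(f(P_1),\dots,f(P_n)) : f\in L(aQ)\}\subseteq\mathbb{F}^n$$ be the corresponding one-point code. For $i=1,\dots,n$ let $m_i$ be the minimal integer such that $\dim C_L(D,m_iQ)=i$ (so that $0<C_L(D,m_1Q)<\cdots<C_L(D,m_nQ)=\mathbb{F}^n$ is the complete flag of one-point codes), and let $W^*=\{m_1,\dots,m_n\}$ be the set of geometric nongaps. Let $W\subseteq\mathbb{N}_0$ be the Weierstrass semigroup at $Q$, i.e. the set of all pole orders at $Q$ of nonzero rational functions on $\mathcal{X}$ that are regular outside $Q$. Then $W\setminus W^*$ is an ideal of $W$; that is, for all $a\in W\setminus W^*$ and $b\in W$ one has $a+b\in W\setminus W^*$. No lower bound on $n$ in terms of the genus is assumed. -/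

import Mathlib

/-!
If `a ∈ W`, then `L((a - 1)Q)` has codimension one in `L(aQ)`, because leading terms at the
rational point `Q` can be cancelled by scalar multiples of one function. Hence the images of these
two spaces under evaluation agree, i.e. `a ∉ W*`, if and only if some function in
`L(aQ) \ L((a - 1)Q)` evaluates to zero. So `W \ W*` is the set of pole orders of the functions that
are regular outside `Q` and vanish at all `Pᵢ`. Those functions form an ideal of the ring of
functions regular outside `Q`, and pole orders add under multiplication.
-/

universe u

open AlgebraicGeometry CategoryTheory
open scoped Polynomial

/-- In a standard smooth algebra of relative dimension one over a field, the maximal ideal of every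
local ring is principal. -/
theorem isPrincipal_maximalIdeal_of_isStandardSmooth (F S L : Type u) [Field F] [CommRing S] [Algebra F S]
    [Algebra.IsStandardSmoothOfRelativeDimension 1 F S] (q : Ideal S) [q.IsPrime]
    [CommRing L] [Algebra S L] [IsLocalization.AtPrime L q] [IsLocalRing L] :
    (IsLocalRing.maximalIdeal L).IsPrincipal := by
  have : Nontrivial S :=
    ⟨0, 1, fun h => ‹q.IsPrime›.ne_top ((Ideal.eq_top_iff_one q).2 (h ▸ q.zero_mem))⟩
  have hss : Algebra.IsStandardSmooth F S :=
    Algebra.IsStandardSmoothOfRelativeDimension.isStandardSmooth 1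
  obtain ⟨-, I, b, hb⟩ := Algebra.IsStandardSmooth.iff_exists_basis_kaehlerDifferential.1 hss
  have hr := Algebra.IsStandardSmoothOfRelativeDimension.rank_kaehlerDifferential
    (R := F) (S := S) (n := 1)
  have hI : Cardinal.mk I = 1 := by
    have := b.mk_eq_rank
    rw [hr] at this
    simpa using this
  obtain ⟨hsub, ⟨i⟩⟩ := Cardinal.eq_one_iff_unique.1 hI
  obtain ⟨t, ht⟩ := hb ⟨i, rfl⟩
  let φ : F[X] →ₐ[F] S := Polynomial.aeval t
  let _ : Algebra F[X] S := φ.toRingHom.toAlgebra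
  have : IsScalarTower F F[X] S := IsScalarTower.of_algebraMap_eq' φ.comp_algebraMap.symm
  have hX : algebraMap F[X] S Polynomial.X = t := by
    change Polynomial.aeval t Polynomial.X = t
    simp
  have : Subsingleton (Ω[S⁄F[X]]) := by
    refine subsingleton_of_forall_eq 0 fun y => ?_
    obtain ⟨w, rfl⟩ := KaehlerDifferential.map_surjective F F[X] S y
    have : Fintype I := Fintype.ofSubsingleton i
    rw [← b.sum_repr w, Fintype.sum_subsingleton _ i, ← ht, map_smul, KaehlerDifferential.map_D,
      ← hX]
    simp
  have : Algebra.FormallyUnramified F[X] S := ⟨inferInstance⟩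
  have : Algebra.EssFiniteType F[X] S := .of_comp F _ _
  let p := q.comap (algebraMap F[X] S)
  have : q.LiesOver p := ⟨rfl⟩
  let _ := Localization.AtPrime.algebraOfLiesOver p q
  have hm := ((Algebra.isUnramifiedAt_iff_map_eq F[X] p q).1 inferInstance).2
  have h1 : (IsLocalRing.maximalIdeal (Localization.AtPrime q)).IsPrincipal := by
    rw [← hm]
    infer_instance
  rw [← IsLocalRing.map_ringEquiv_maximalIdeal
    (IsLocalization.algEquiv q.primeCompl (Localization.AtPrime q) L).toRingEquiv]
  exact Submodule.IsPrincipal.map_ringHom _ h1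

/-- A smooth absolutely irreducible projective curve over the field `F`. (A curve over a field is
projective if and only if it is proper, and for a smooth scheme over a field, absolutely irreducible
is the same as geometrically integral.) -/
structure SmoothProjectiveCurve (F : Type u) [Field F] where
  X : Scheme.{u}
  π : X ⟶ Spec (.of F)
  smooth : SmoothOfRelativeDimension 1 π
  proper : IsProper π
  geometricallyIntegral : GeometricallyIntegral π

namespace SmoothProjectiveCurve
variable {F : Type u} [Field F] (C : SmoothProjectiveCurve F)

instance : IsIntegral C.X :=
  have := C.geometricallyIntegral
  GeometricallyIntegral.isIntegral_of_subsingleton C.π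

instance : IsLocallyNoetherian C.X :=
  have := C.proper
  LocallyOfFiniteType.isLocallyNoetherian C.π

theorem isPrincipalIdealRing_stalk (x : C.X) : IsPrincipalIdealRing (C.X.presheaf.stalk x) := by
  obtain ⟨U, hU, V, hV, hx, e, h⟩ := C.smooth.exists_isStandardSmoothOfRelativeDimension x
  have hUt : U = ⊤ := by
    refine top_unique fun y _ => ?_
    rw [Subsingleton.elim y (C.π x)]
    exact e hx
  have hF : IsField Γ(Spec (.of F), U) := by
    subst hUt
    exact MulEquiv.isField (Field.toIsField F)
      (Scheme.ΓSpecIso (.of F)).commRingCatIsoToRingEquiv.toMulEquiv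
  let _ := hF.toField
  let _ := (C.π.appLE U V e).hom.toAlgebra
  have : Algebra.IsStandardSmoothOfRelativeDimension 1 Γ(Spec (.of F), U) Γ(C.X, V) := h
  let y : V := ⟨x, hx⟩
  let _ := TopCat.Presheaf.algebra_section_stalk C.X.presheaf y
  have := hV.isLocalization_stalk y
  have := isPrincipal_maximalIdeal_of_isStandardSmooth Γ(Spec (.of F), U) Γ(C.X, V) (C.X.presheaf.stalk x)
    (hV.primeIdealOf y).asIdeal
  exact ((tfae_of_isNoetherianRing_of_isLocalRing_of_isDomain
    (C.X.presheaf.stalk x)).out 4 0).1 this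

/-- The local rings of the closed points are discrete valuation rings. -/
theorem isDiscreteValuationRing_stalk {x : C.X} (hx : Order.coheight x = 1) :
    IsDiscreteValuationRing (C.X.presheaf.stalk x) := by
  have := C.isPrincipalIdealRing_stalk x
  have h := ringKrullDim_stalk_eq_coheight x
  refine ⟨fun hb => ?_⟩
  have := ringKrullDim_eq_zero_of_isField (IsLocalRing.isField_iff_maximalIdeal_eq.2 hb)
  rw [this, hx] at h
  exact absurd h (by decide)

/-- The local rings, in particular the function field, are algebras over the base field through the
structure morphism. -/
noncomputable instance (x : C.X) : Algebra F (C.X.presheaf.stalk x) :=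
  (CommRingCat.Hom.hom ((Scheme.ΓSpecIso (.of F)).inv ≫ C.π.appTop ≫
    C.X.presheaf.germ ⊤ x trivial)).toAlgebra

instance (x : C.X) : IsScalarTower F (C.X.presheaf.stalk x) C.X.functionField := by
  refine IsScalarTower.of_algebraMap_eq' ?_
  simp only [RingHom.algebraMap_toAlgebra]
  rw [← CommRingCat.hom_comp]
  simp only [Category.assoc]
  congr 3
  exact (C.X.presheaf.germ_stalkSpecializes (U := ⊤) trivial _).symm

theorem coheight_eq_one_or_isField (x : C.X) :
    Order.coheight x = 1 ∨ IsField (C.X.presheaf.stalk x) := by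
  by_cases h : IsField (C.X.presheaf.stalk x)
  · exact .inr h
  · have := C.isPrincipalIdealRing_stalk x
    have h1 := IsPrincipalIdealRing.ringKrullDim_eq_one (C.X.presheaf.stalk x) h
    rw [ringKrullDim_stalk_eq_coheight] at h1
    exact .inl (by exact_mod_cast h1)

theorem ord_algebraMap {x : C.X} {c : F} (hc : c ≠ 0) :
    C.X.ord (algebraMap F C.X.functionField c) x = 0 :=
  have : Nonempty (⊤ : C.X.Opens) := ⟨⟨x, trivial⟩⟩
  Scheme.ord_of_isUnit (U := ⊤)
    (((isUnit_iff_ne_zero.2 hc).map (Scheme.ΓSpecIso (.of F)).inv.hom).map C.π.appTop.hom) trivial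

/-- The Riemann--Roch space `L(G) = {f | f = 0 or div f + G ≥ 0}` of a divisor `G`. The codimension
one points of the curve are its closed points, and `ord f z` is the order of vanishing. -/
noncomputable def riemannRochSpace (G : C.X →₀ ℤ) : Submodule F C.X.functionField where
  carrier := {f | f = 0 ∨ ∀ z : C.X, Order.coheight z = 1 → 0 ≤ C.X.ord f z + G z}
  zero_mem' := .inl rfl
  add_mem' := by
    intro f g hf hg
    rcases hf with rfl | hf
    · simpa using hg
    rcases hg with rfl | hg
    · simpa using Or.inr hf
    by_cases hfg : f + g = 0
    · exact .inl hfg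
    · refine .inr fun z hz => ?_
      have := C.isDiscreteValuationRing_stalk hz
      have h1 := Scheme.ord_add (x := z) hfg
      have := hf z hz
      have := hg z hz
      rcases min_le_iff.1 h1 <;> omega
  smul_mem' := by
    intro c f hf
    by_cases hc : c = 0
    · exact .inl (by simp [hc])
    rcases hf with rfl | hf
    · exact .inl (smul_zero c)
    by_cases hf0 : f = 0
    · exact .inl (by simp [hf0])
    · refine .inr fun z hz => ?_
      rw [Algebra.smul_def, Scheme.ord_mul (by simpa using hc) hf0, C.ord_algebraMap hc, zero_add]
      exact hf z hz

/-- A function in `L(G)` is regular outside the support of `G`. -/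
theorem exists_algebraMap_eq {G : C.X →₀ ℤ} {f : C.X.functionField}
    (hf : f ∈ C.riemannRochSpace G) {x : C.X} (hx : G x = 0) :
    ∃ h : C.X.presheaf.stalk x, algebraMap _ C.X.functionField h = f := by
  rcases C.coheight_eq_one_or_isField x with h1 | hfld
  · rcases hf with rfl | hf
    · exact ⟨0, map_zero _⟩
    by_cases hf0 : f = 0
    · exact ⟨0, by rw [map_zero, hf0]⟩
    have := C.isDiscreteValuationRing_stalk h1
    have h2 := hf x h1
    rw [hx, add_zero, Scheme.le_ord_iff h1 hf0] at h2
    apply IsDiscreteValuationRing.exists_lift_of_le_one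
    have h3 : (1 : WithZero (Multiplicative ℤ)) ≤ Ring.ordFrac (C.X.presheaf.stalk x) f := h2
    rw [Ring.ordFrac_eq_valuation_inv] at h3
    exact (one_le_inv₀ (zero_lt_iff.2 (by simpa using hf0))).1 h3
  · exact IsFractionRing.surjective_iff_isField.2 hfld f

/-- A rational point: a point whose residue field is the base field. -/
@[ext]
structure RationalPoint where
  pt : C.X
  bijective : Function.Bijective
    ((C.X.residue pt).hom.comp (algebraMap F (C.X.presheaf.stalk pt)))

variable {C}

/-- The value at `P` of a germ of a regular function at `P`. -/
noncomputable def RationalPoint.germValue (P : C.RationalPoint) :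
    C.X.presheaf.stalk P.pt →ₐ[F] F where
  toRingHom := (RingEquiv.ofBijective _ P.bijective).symm.toRingHom.comp (C.X.residue P.pt).hom
  commutes' c := (RingEquiv.ofBijective _ P.bijective).symm_apply_apply c

/-- The functions on the curve that are regular at the point `x`. -/
noncomputable def regularFunctions (x : C.X) : Subalgebra F C.X.functionField :=
  (IsScalarTower.toAlgHom F (C.X.presheaf.stalk x) C.X.functionField).range

/-- Evaluation `f ↦ f(P)` of the functions that are regular at `P`. -/
noncomputable def RationalPoint.value (P : C.RationalPoint) : regularFunctions P.pt →ₐ[F] F :=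
  P.germValue.comp (AlgEquiv.ofInjective
    (IsScalarTower.toAlgHom F (C.X.presheaf.stalk P.pt) C.X.functionField)
    (IsFractionRing.injective _ _)).symm.toAlgHom

/-- The evaluation map `ev_D : L(G) → Fⁿ`, `f ↦ (f(P₁), …, f(Pₙ))`, for a divisor `G` whose support
is disjoint from `D = P₁ + ⋯ + Pₙ`. -/
noncomputable def evalMap {n : ℕ} (P : Fin n → C.RationalPoint) (G : C.X →₀ ℤ)
    (hG : ∀ i, G (P i).pt = 0) : C.riemannRochSpace G →ₗ[F] (Fin n → F) :=
  LinearMap.pi fun i => (P i).value.toLinearMap ∘ₗ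
    Submodule.inclusion (p' := Subalgebra.toSubmodule (regularFunctions (P i).pt))
      (fun _ hf => C.exists_algebraMap_eq hf (hG i))

/-- The algebraic geometry code `C_L(D, G)`. -/
noncomputable def agCode {n : ℕ} (P : Fin n → C.RationalPoint) (G : C.X →₀ ℤ)
    (hG : ∀ i, G (P i).pt = 0) : Submodule F (Fin n → F) :=
  LinearMap.range (evalMap P G hG)

/-- The one-point code `C_L(D, aQ)`. -/
noncomputable def onePointCode {n : ℕ} (P : Fin n → C.RationalPoint) (Q : C.RationalPoint)
    (hQ : ∀ i, P i ≠ Q) (a : ℤ) : Submodule F (Fin n → F) :=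
  agCode P (Finsupp.single Q.pt a)
    fun i => Finsupp.single_eq_of_ne fun h => hQ i (RationalPoint.ext h)

/-- The set `W* = {m₁, …, mₙ}` of geometric nongaps: `mᵢ` is the minimal integer `b` such that
`dim C_L(D, bQ) = i`, so that the `C_L(D, mᵢQ)` form the complete flag of one-point codes. (The
`mᵢ` are nonnegative since `L(bQ) = 0` for `b < 0`.) -/
def geometricNongaps {n : ℕ} (P : Fin n → C.RationalPoint) (Q : C.RationalPoint)
    (hQ : ∀ i, P i ≠ Q) : Set ℕ :=
  {a | ∃ i : ℕ, 1 ≤ i ∧ i ≤ n ∧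
    IsLeast {b : ℤ | Module.finrank F (onePointCode P Q hQ b) = i} (a : ℤ)}

/-- The Weierstrass semigroup `W` at `Q`: the pole orders at `Q` of the functions that have no pole
outside `Q`. -/
def weierstrassSemigroup (Q : C.RationalPoint) : AddSubmonoid ℕ where
  carrier := {a | ∃ f : C.X.functionField, f ≠ 0 ∧ C.X.ord f Q.pt = -(a : ℤ) ∧
    ∀ z : C.X, Order.coheight z = 1 → z ≠ Q.pt → 0 ≤ C.X.ord f z}
  zero_mem' := by
    have h (z : C.X) : C.X.ord (1 : C.X.functionField) z = 0 := by
      simpa using C.ord_algebraMap (x := z) (one_ne_zero (α := F))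
    exact ⟨1, one_ne_zero, by simp [h], fun z _ _ => (h z).ge⟩
  add_mem' := by
    rintro a b ⟨f, hf, hfa, hf'⟩ ⟨g, hg, hgb, hg'⟩
    refine ⟨f * g, mul_ne_zero hf hg, ?_, fun z hz hzQ => ?_⟩
    · rw [Scheme.ord_mul hf hg, hfa, hgb]
      push_cast
      ring
    · rw [Scheme.ord_mul hf hg]
      exact add_nonneg (hf' z hz hzQ) (hg' z hz hzQ)

end SmoothProjectiveCurve

/-- An ideal of a semigroup `S` of natural numbers: a subset `I` of `S` with `I + S ⊆ I`. -/
def IsSemigroupIdeal (S : AddSubmonoid ℕ) (I : Set ℕ) : Prop :=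
  I ⊆ S ∧ ∀ i ∈ I, ∀ s ∈ S, i + s ∈ I

theorem not_surjective_algebraMap_of_isStandardSmooth (R S L : Type*) [CommRing R] [CommRing S]
    [CommRing L] [Nontrivial L] [Algebra R S] [Algebra S L] [Algebra R L] [IsScalarTower R S L]
    [Algebra.FormallyEtale S L] {n : ℕ} (hn : n ≠ 0)
    [Algebra.IsStandardSmoothOfRelativeDimension n R S] :
    ¬ Function.Surjective (algebraMap R L) := by
  intro hsurj
  have : Nontrivial S := (algebraMap S L).domain_nontrivial
  have : Algebra.IsStandardSmooth R S :=
    Algebra.IsStandardSmoothOfRelativeDimension.isStandardSmooth n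
  have hΩ : Subsingleton (Ω[L⁄R]) := KaehlerDifferential.subsingleton_of_surjective R L hsurj
  have hrank : Module.rank S (Ω[S⁄R]) = n :=
    Algebra.IsStandardSmoothOfRelativeDimension.rank_kaehlerDifferential n
  have hrankL : Module.finrank L (TensorProduct S L (Ω[S⁄R])) = n := by
    rw [Module.finrank_baseChange, Module.finrank_eq_of_rank_eq hrank]
  have : Subsingleton (TensorProduct S L (Ω[S⁄R])) :=
    (KaehlerDifferential.tensorKaehlerEquivOfFormallyEtale R S L).toEquiv.subsingleton
  exact hn (hrankL.symm.trans (Module.finrank_zero_of_subsingleton ..))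

namespace SmoothProjectiveCurve
variable {F : Type u} [Field F] {C : SmoothProjectiveCurve F}

theorem not_surjective_algebraMap_stalk (x : C.X) :
    ¬ Function.Surjective (algebraMap F (C.X.presheaf.stalk x)) := by
  obtain ⟨U, -, V, hV, hx, e, hsmooth⟩ :=
    C.smooth.exists_isStandardSmoothOfRelativeDimension x
  obtain rfl : U = ⊤ := top_unique fun y _ => Subsingleton.elim (C.π x) y ▸ e hx
  let _ := (C.π.appLE ⊤ V e).hom.toAlgebra
  let _ := TopCat.Presheaf.algebra_section_stalk C.X.presheaf ⟨x, hx⟩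
  let _ := ((C.X.presheaf.germ V x hx).hom.comp (C.π.appLE ⊤ V e).hom).toAlgebra
  have : IsScalarTower Γ(Spec (.of F), ⊤) Γ(C.X, V) (C.X.presheaf.stalk x) :=
    .of_algebraMap_eq' rfl
  have : Algebra.IsStandardSmoothOfRelativeDimension 1 Γ(Spec (.of F), ⊤) Γ(C.X, V) := hsmooth
  have := hV.isLocalization_stalk ⟨x, hx⟩
  have : Algebra.FormallyEtale Γ(C.X, V) (C.X.presheaf.stalk x) :=
    .of_isLocalization (hV.primeIdealOf ⟨x, hx⟩).asIdeal.primeCompl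
  have hfactor : algebraMap F (C.X.presheaf.stalk x) =
      (algebraMap Γ(Spec (.of F), ⊤) (C.X.presheaf.stalk x)).comp
        (Scheme.ΓSpecIso (.of F)).inv.hom := by
    simp only [RingHom.algebraMap_toAlgebra, ← CommRingCat.hom_comp, Scheme.Hom.appLE,
      Category.assoc, TopCat.Presheaf.germ_res]
    rfl
  rw [hfactor, RingHom.coe_comp]
  exact fun hsurj => not_surjective_algebraMap_of_isStandardSmooth Γ(Spec (.of F), ⊤) Γ(C.X, V)
    (C.X.presheaf.stalk x) one_ne_zero hsurj.of_comp

theorem RationalPoint.germValue_eq_zero_iff (P : C.RationalPoint)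
    {h : C.X.presheaf.stalk P.pt} : P.germValue h = 0 ↔ ¬ IsUnit h := by
  rw [← mem_nonunits_iff, ← IsLocalRing.mem_maximalIdeal, ← IsLocalRing.residue_eq_zero_iff]
  exact map_eq_zero_iff _ (RingEquiv.ofBijective _ P.bijective).symm.injective

theorem RationalPoint.coheight_pt (P : C.RationalPoint) : Order.coheight P.pt = 1 := by
  refine (C.coheight_eq_one_or_isField P.pt).resolve_right fun hfield => ?_
  -- Evaluation at `P` would identify a stalk that is a field with `F`.
  refine not_surjective_algebraMap_stalk P.pt fun h => ⟨P.germValue h, ?_⟩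
  have hval : P.germValue (h - algebraMap F _ (P.germValue h)) = 0 := by
    rw [map_sub, AlgHom.commutes, Algebra.algebraMap_self_apply, sub_self]
  rw [P.germValue_eq_zero_iff] at hval
  by_contra hne
  obtain ⟨k, hk⟩ := hfield.mul_inv_cancel (sub_ne_zero.2 (Ne.symm hne))
  exact hval (.of_mul_eq_one k hk)

section Order

variable {x : C.X}

theorem ord_div {f g : C.X.functionField} (hf : f ≠ 0) (hg : g ≠ 0) :
    C.X.ord (f / g) x = C.X.ord f x - C.X.ord g x := by
  rw [eq_sub_iff_add_eq, ← Scheme.ord_mul (div_ne_zero hf hg) hg, div_mul_cancel₀ f hg]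

theorem ord_nonneg_iff_mem_regularFunctions (hx : Order.coheight x = 1)
    {f : C.X.functionField} : 0 ≤ C.X.ord f x ↔ f ∈ regularFunctions x := by
  rcases eq_or_ne f 0 with rfl | hf
  · simp
  have := C.isDiscreteValuationRing_stalk hx
  have hval : 0 ≤ C.X.ord f x ↔ (IsDiscreteValuationRing.maximalIdeal
      (C.X.presheaf.stalk x)).valuation C.X.functionField f ≤ 1 := by
    rw [Scheme.le_ord_iff hx hf, ← one_le_inv₀ (zero_lt_iff.2 (by simpa using hf)),
      ← Ring.ordFrac_eq_valuation_inv]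
    rfl
  rw [hval]
  refine ⟨IsDiscreteValuationRing.exists_lift_of_le_one, ?_⟩
  rintro ⟨h, rfl⟩
  exact IsDedekindDomain.HeightOneSpectrum.valuation_le_one _ h

theorem ord_algebraMap_eq_zero_iff_isUnit (hx : Order.coheight x = 1)
    {h : C.X.presheaf.stalk x} (hh : h ≠ 0) :
    C.X.ord (algebraMap _ C.X.functionField h) x = 0 ↔ IsUnit h := by
  have := C.isDiscreteValuationRing_stalk hx
  rw [Scheme.ord_eq_iff hx ((map_ne_zero_iff _ (IsFractionRing.injective _ _)).2 hh)]
  exact Ring.isUnit_iff_ordFrac_one_of_isDiscreteValuationRing.symm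

theorem RationalPoint.value_eq_zero_iff (P : C.RationalPoint) {f : regularFunctions P.pt}
    (hf : (f : C.X.functionField) ≠ 0) :
    P.value f = 0 ↔ 0 < C.X.ord (f : C.X.functionField) P.pt := by
  obtain ⟨f, h, rfl⟩ := f
  have hh : h ≠ 0 := fun h0 => hf (by simp [h0])
  have hvalue : P.value ⟨_, h, rfl⟩ = P.germValue h :=
    congrArg P.germValue ((AlgEquiv.ofInjective
      (IsScalarTower.toAlgHom F (C.X.presheaf.stalk P.pt) C.X.functionField)
      (IsFractionRing.injective _ _)).symm_apply_apply h)
  have hnonneg := (ord_nonneg_iff_mem_regularFunctions P.coheight_pt).2 ⟨h, rfl⟩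
  rw [hvalue, P.germValue_eq_zero_iff, ← ord_algebraMap_eq_zero_iff_isUnit P.coheight_pt hh]
  exact hnonneg.lt_iff_ne'.symm

theorem RationalPoint.exists_ord_lt_ord_sub_smul (P : C.RationalPoint) {u v : C.X.functionField}
    (hv : v ≠ 0) (huv : u / v ∈ regularFunctions P.pt) :
    ∃ c : F, u - c • v = 0 ∨ C.X.ord v P.pt < C.X.ord (u - c • v) P.pt := by
  let c := P.value ⟨u / v, huv⟩
  let w : regularFunctions P.pt := ⟨u / v, huv⟩ - algebraMap F _ c
  have hw : P.value w = 0 := by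
    rw [map_sub, AlgHom.commutes, Algebra.algebraMap_self_apply, sub_self]
  have hmul : u - c • v = w * v := by
    change _ = (u / v - algebraMap F _ c) * v
    rw [sub_mul, div_mul_cancel₀ u hv, Algebra.smul_def]
  refine ⟨c, or_iff_not_imp_left.2 fun hne => ?_⟩
  rw [hmul] at hne ⊢
  have hw0 : (w : C.X.functionField) ≠ 0 := left_ne_zero_of_mul hne
  rw [Scheme.ord_mul hw0 hv]
  exact lt_add_of_pos_left _ ((P.value_eq_zero_iff hw0).1 hw)

end Order

section RiemannRochSpace

variable {G H : C.X →₀ ℤ} {f : C.X.functionField}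

theorem mem_riemannRochSpace_iff_of_ne_zero (hf : f ≠ 0) :
    f ∈ C.riemannRochSpace G ↔ ∀ z : C.X, Order.coheight z = 1 → 0 ≤ C.X.ord f z + G z :=
  or_iff_right hf

theorem riemannRochSpace_mono : Monotone C.riemannRochSpace := by
  rintro G H hGH f (rfl | hf)
  · exact zero_mem _
  · exact .inr fun z hz => (hf z hz).trans (by gcongr; exact hGH z)

theorem mem_riemannRochSpace_sub_single_iff {x : C.X} (hx : Order.coheight x = 1) (hf : f ≠ 0) :
    f ∈ C.riemannRochSpace (G - Finsupp.single x 1) ↔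
      f ∈ C.riemannRochSpace G ∧ 0 < C.X.ord f x + G x := by
  simp only [mem_riemannRochSpace_iff_of_ne_zero hf, Finsupp.sub_apply]
  constructor
  · intro h
    refine ⟨fun z hz => ?_, ?_⟩
    · have := h z hz
      have : 0 ≤ Finsupp.single x (1 : ℤ) z := Finsupp.single_nonneg.2 zero_le_one z
      omega
    · have := h x hx
      rw [Finsupp.single_eq_same] at this
      omega
  · rintro ⟨h, hfx⟩ z hz
    rcases eq_or_ne z x with rfl | hzx
    · rw [Finsupp.single_eq_same]
      omega
    · simpa [Finsupp.single_eq_of_ne hzx] using h z hz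

theorem riemannRochSpace_sub_single_wcovBy (P : C.RationalPoint) (G : C.X →₀ ℤ) :
    C.riemannRochSpace (G - Finsupp.single P.pt 1) ⩿ C.riemannRochSpace G := by
  refine ⟨riemannRochSpace_mono (sub_le_self _ (Finsupp.single_nonneg.2 zero_le_one)),
    fun K hK hKG => ?_⟩
  obtain ⟨v, hvK, hv⟩ := SetLike.exists_of_lt hK
  obtain ⟨u, hu, huK⟩ := SetLike.exists_of_lt hKG
  have hv0 : v ≠ 0 := fun h => hv (h ▸ zero_mem _)
  have hu0 : u ≠ 0 := fun h => huK (h ▸ zero_mem _)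
  have hvP : C.X.ord v P.pt + G P.pt = 0 := by
    refine (not_lt.1 fun h => hv ?_).antisymm
      ((mem_riemannRochSpace_iff_of_ne_zero hv0).1 (hKG.le hvK) P.pt P.coheight_pt)
    exact (mem_riemannRochSpace_sub_single_iff P.coheight_pt hv0).2 ⟨hKG.le hvK, h⟩
  have huP := (mem_riemannRochSpace_iff_of_ne_zero hu0).1 hu P.pt P.coheight_pt
  have huv : u / v ∈ regularFunctions P.pt := by
    rw [← ord_nonneg_iff_mem_regularFunctions P.coheight_pt, ord_div hu0 hv0]
    omega
  obtain ⟨c, hc⟩ := P.exists_ord_lt_ord_sub_smul hv0 huv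
  have hsub : u - c • v ∈ K := by
    rcases eq_or_ne (u - c • v) 0 with h0 | h0
    · exact h0 ▸ zero_mem _
    · refine hK.le ((mem_riemannRochSpace_sub_single_iff P.coheight_pt h0).2
        ⟨sub_mem hu (Submodule.smul_mem _ c (hKG.le hvK)), ?_⟩)
      have := hc.resolve_left h0
      omega
  exact huK ((Submodule.sub_mem_iff_left K (Submodule.smul_mem K c hvK)).1 hsub)

theorem mem_riemannRochSpace_single_and_notMem_iff {x : C.X} (hx : Order.coheight x = 1) {a : ℤ} :
    f ∈ C.riemannRochSpace (Finsupp.single x a) ∧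
        f ∉ C.riemannRochSpace (Finsupp.single x (a - 1)) ↔
      f ≠ 0 ∧ C.X.ord f x = -a ∧
        ∀ z : C.X, Order.coheight z = 1 → z ≠ x → 0 ≤ C.X.ord f z := by
  rcases eq_or_ne f 0 with rfl | hf
  · simp
  rw [Finsupp.single_sub, mem_riemannRochSpace_sub_single_iff hx hf,
    mem_riemannRochSpace_iff_of_ne_zero hf, Finsupp.single_eq_same]
  constructor
  · rintro ⟨h, hfx⟩
    have hle := h x hx
    rw [Finsupp.single_eq_same] at hle
    have hnot_pos : ¬ 0 < C.X.ord f x + a := fun hpos => hfx ⟨h, hpos⟩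
    refine ⟨hf, by omega, fun z hz hzx => ?_⟩
    simpa [Finsupp.single_eq_of_ne hzx] using h z hz
  · rintro ⟨-, hfx, h⟩
    refine ⟨fun z hz => ?_, fun hpos => by omega⟩
    rcases eq_or_ne z x with rfl | hzx
    · rw [Finsupp.single_eq_same]
      omega
    · simpa [Finsupp.single_eq_of_ne hzx] using h z hz hzx

end RiemannRochSpace

section Codes

variable {n : ℕ} {P : Fin n → C.RationalPoint} {G H : C.X →₀ ℤ}

theorem evalMap_eq_zero_iff (hG : ∀ i, G (P i).pt = 0) {f : C.riemannRochSpace G}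
    (hf : (f : C.X.functionField) ≠ 0) :
    evalMap P G hG f = 0 ↔ ∀ i, 0 < C.X.ord (f : C.X.functionField) (P i).pt :=
  funext_iff.trans <| forall_congr' fun i => (P i).value_eq_zero_iff
    (f := ⟨f, C.exists_algebraMap_eq f.2 (hG i)⟩) hf

theorem agCode_eq_map_submoduleOf (hG : ∀ i, G (P i).pt = 0) (hH : ∀ i, H (P i).pt = 0)
    (hGH : C.riemannRochSpace G ≤ C.riemannRochSpace H) :
    agCode P G hG =
      ((C.riemannRochSpace G).submoduleOf (C.riemannRochSpace H)).map (evalMap P H hH) := by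
  ext y
  constructor
  · rintro ⟨⟨f, hf⟩, rfl⟩
    exact ⟨⟨f, hGH hf⟩, hf, rfl⟩
  · rintro ⟨⟨f, _⟩, hf, rfl⟩
    exact ⟨⟨f, hf⟩, rfl⟩

theorem agCode_mono (hG : ∀ i, G (P i).pt = 0) (hH : ∀ i, H (P i).pt = 0) (hGH : G ≤ H) :
    agCode P G hG ≤ agCode P H hH :=
  (agCode_eq_map_submoduleOf hG hH (riemannRochSpace_mono hGH)).trans_le LinearMap.map_le_range

theorem agCode_eq_iff_of_covBy (hG : ∀ i, G (P i).pt = 0) (hH : ∀ i, H (P i).pt = 0)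
    (hGH : C.riemannRochSpace G ⋖ C.riemannRochSpace H) :
    agCode P G hG = agCode P H hH ↔ ∃ f : C.X.functionField,
      (f ∈ C.riemannRochSpace H ∧ f ∉ C.riemannRochSpace G) ∧ ∀ i, 0 < C.X.ord f (P i).pt := by
  have hcoatom : IsCoatom ((C.riemannRochSpace G).submoduleOf (C.riemannRochSpace H)) :=
    isSimpleModule_iff_isCoatom.1 ((covBy_iff_quot_is_simple hGH.le).1 hGH)
  rw [agCode_eq_map_submoduleOf hG hH hGH.le, agCode, Submodule.map_eq_range_iff,
    ← hcoatom.not_le_iff_codisjoint, SetLike.not_le_iff_exists]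
  constructor
  · rintro ⟨⟨f, hfH⟩, hev, hfG⟩
    have hf0 : f ≠ 0 := fun h => hfG (by subst h; exact zero_mem _)
    exact ⟨f, ⟨hfH, hfG⟩, (evalMap_eq_zero_iff hH (f := ⟨f, hfH⟩) hf0).1 (LinearMap.mem_ker.1 hev)⟩
  · rintro ⟨f, ⟨hfH, hfG⟩, hev⟩
    have hf0 : f ≠ 0 := fun h => hfG (h ▸ zero_mem _)
    exact ⟨⟨f, hfH⟩,
      LinearMap.mem_ker.2 ((evalMap_eq_zero_iff hH (f := ⟨f, hfH⟩) hf0).2 hev), hfG⟩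

variable {Q : C.RationalPoint} {a : ℕ}

theorem onePointCode_mono (hQ : ∀ i, P i ≠ Q) : Monotone (onePointCode P Q hQ) :=
  fun _ _ hab => agCode_mono _ _ (Finsupp.single_mono hab)

theorem mem_geometricNongaps_iff (hQ : ∀ i, P i ≠ Q) :
    a ∈ geometricNongaps P Q hQ ↔ onePointCode P Q hQ (a - 1) ≠ onePointCode P Q hQ a := by
  have hmono := onePointCode_mono hQ
  constructor
  · rintro ⟨i, -, -, hi, hmin⟩ heq
    have := hmin (a := (a : ℤ) - 1) (by rw [Set.mem_ofPred_eq, heq]; exact hi)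
    omega
  · intro hne
    have hlt := Submodule.finrank_lt_finrank_of_lt ((hmono (sub_one_lt (a : ℤ)).le).lt_of_ne hne)
    refine ⟨Module.finrank F (onePointCode P Q hQ a), by omega, ?_, rfl, fun b hb => ?_⟩
    · simpa using Submodule.finrank_le (onePointCode P Q hQ a)
    · by_contra! hba
      have hle := Submodule.finrank_mono (hmono (Int.le_sub_one_of_lt hba))
      rw [Set.mem_ofPred_eq] at hb
      omega

theorem riemannRochSpace_covBy_of_mem_weierstrassSemigroup (ha : a ∈ weierstrassSemigroup Q) :
    C.riemannRochSpace (Finsupp.single Q.pt (a - 1 : ℤ)) ⋖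
      C.riemannRochSpace (Finsupp.single Q.pt (a : ℤ)) := by
  obtain ⟨f, hf⟩ := ha
  obtain ⟨hmem, hnotMem⟩ := (mem_riemannRochSpace_single_and_notMem_iff Q.coheight_pt).2 hf
  have hwcov := riemannRochSpace_sub_single_wcovBy Q (Finsupp.single Q.pt (a : ℤ))
  rw [← Finsupp.single_sub] at hwcov
  exact hwcov.covBy_of_not_le fun hle => hnotMem (hle hmem)

theorem mem_weierstrassSemigroup_sdiff_geometricNongaps_iff (hQ : ∀ i, P i ≠ Q) :
    a ∈ (weierstrassSemigroup Q : Set ℕ) \ geometricNongaps P Q hQ ↔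
      ∃ f : C.X.functionField, (f ≠ 0 ∧ C.X.ord f Q.pt = -(a : ℤ) ∧
        ∀ z : C.X, Order.coheight z = 1 → z ≠ Q.pt → 0 ≤ C.X.ord f z) ∧
          ∀ i, 0 < C.X.ord f (P i).pt := by
  have hcode (ha : a ∈ weierstrassSemigroup Q) := agCode_eq_iff_of_covBy (P := P)
    (fun i => Finsupp.single_eq_of_ne fun h => hQ i (RationalPoint.ext h))
    (fun i => Finsupp.single_eq_of_ne fun h => hQ i (RationalPoint.ext h))
    (riemannRochSpace_covBy_of_mem_weierstrassSemigroup ha)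
  simp only [mem_riemannRochSpace_single_and_notMem_iff Q.coheight_pt] at hcode
  rw [Set.mem_sdiff, mem_geometricNongaps_iff, not_not]
  constructor
  · rintro ⟨ha, heq⟩
    exact (hcode ha).1 heq
  · rintro ⟨f, hf, hfP⟩
    exact ⟨⟨f, hf⟩, (hcode ⟨f, hf⟩).2 ⟨f, hf, hfP⟩⟩

end Codes

end SmoothProjectiveCurve

open SmoothProjectiveCurve in
theorem mainTheorem6_general {F : Type u} [Field F] (C : SmoothProjectiveCurve F) (n : ℕ)
    (P : Fin n → C.RationalPoint) (Q : C.RationalPoint) (hQ : ∀ i, P i ≠ Q) :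
    IsSemigroupIdeal (weierstrassSemigroup Q)
      ((weierstrassSemigroup Q : Set ℕ) \ geometricNongaps P Q hQ) := by
  refine ⟨Set.sdiff_subset, fun a ha b hb => ?_⟩
  rw [mem_weierstrassSemigroup_sdiff_geometricNongaps_iff] at ha ⊢
  obtain ⟨f, ⟨hf0, hfQ, hf⟩, hfP⟩ := ha
  obtain ⟨g, hg0, hgQ, hg⟩ := hb
  refine ⟨f * g, ⟨mul_ne_zero hf0 hg0, ?_, fun z hz hzQ => ?_⟩, fun i => ?_⟩
  · rw [Scheme.ord_mul hf0 hg0, hfQ, hgQ, Nat.cast_add, neg_add]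
  · rw [Scheme.ord_mul hf0 hg0]
    exact add_nonneg (hf z hz hzQ) (hg z hz hzQ)
  · rw [Scheme.ord_mul hf0 hg0]
    exact add_pos_of_pos_of_nonneg (hfP i)
      (hg _ (P i).coheight_pt fun h => hQ i (RationalPoint.ext h))

theorem mainTheorem6 {F : Type u} [Field F] [Finite F] (C : SmoothProjectiveCurve F) (n : ℕ)
    (P : Fin n → C.RationalPoint) (Q : C.RationalPoint) (hP : Function.Injective P)
    (hQ : ∀ i, P i ≠ Q) :
    IsSemigroupIdeal (SmoothProjectiveCurve.weierstrassSemigroup Q)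
      ((SmoothProjectiveCurve.weierstrassSemigroup Q : Set ℕ) \
        SmoothProjectiveCurve.geometricNongaps P Q hQ) :=
  mainTheorem6_general C n P Q hQ
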